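/- Let $K$ be a field. For an integer matrix $A\in\mathbb Z^{d\times n}$ with pairwise distinct columns $\mathbf a_1,\dots,\mathbf a_n$, let the toric ideal $I_A\subset K[x_1,\dots,x_n]$ be the kernel of the $K$-algebra homomorphism $K[x_1,\dots,x_n]\to K[t_1^{\pm1},\dots,t_d^{\pm1}]$, $x_j\mapsto t_1^{a_{1j}}\cdots t_d^{a_{dj}}$. A binomial is a difference $u-v$ of two distinct monomials $u,v$ in $x_1,\dots,x_n$; its support is the set of variables that divide $u$ or $v$. A circuit of $I_A$ is an irreducible binomial $f\in I_A$ such that no binomial in $I_A$ has support strictly contained in the support of $f$. For integers $d,r\ge 2$, let $V_d^{(r)}$ be the matrix whose columns are the vectors $(\alpha_1,\dots,\alpha_d)^\top\in\mathbb Z^d$ with all $\alpha_i\ge 0$ and $\sum_{i=1}^d\alpha_i=r$ (each taken once), and let $SV_d^{(r)}$ be the matrix whose columns are the vectors $(\alpha_1,\dots,\alpha_d)^\top\in\{0,1\}^d$ with $\sum_{i=1}^d\alpha_i=r$ (each taken once). **Theorem 1.3.** Let $d,r\ge 2$ be integers. (i) For $A=SV_d^{(r)}$, the ideal $I_A$ is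 generated by the set of circuits $u-v$ of $I_A$ such that both monomials $u$ and $v$ are squarefree. (ii) For $A=V_d^{(r)}$, the ideal $I_A$ is generated by the set of circuits $u-v$ of $I_A$ such that at least one of the monomials $u$, $v$ is squarefree if and only if $r=2$. -/

import Mathlib

open MvPolynomial

namespace Toric

noncomputable section

variable (K : Type*) [Field K] {d : ℕ} {ι : Type*}

/-- The Laurent polynomial ring `K[t₁, t₁⁻¹, …, t_d, t_d⁻¹]`, as the group algebra of `ℤ^d`. -/
abbrev LaurentRing (d : ℕ) : Type _ := AddMonoidAlgebra K (Fin d → ℤ)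

/-- The Laurent monomial `T^a = t₁^{a₁} ⋯ t_d^{a_d}`. -/
def laurentMonomial (a : Fin d → ℤ) : LaurentRing K d := AddMonoidAlgebra.single a 1

/-- The map `π : K[X] → K[T, T⁻¹]`, `x_j ↦ T^{a_j}`, where `a_j` is the `j`-th column of `A`. Its
image is the toric ring `K[A]`. The columns are indexed by an arbitrary type `ι`. -/
def toricMap (A : Matrix (Fin d) ι ℤ) : MvPolynomial ι K →ₐ[K] LaurentRing K d :=
  aeval fun j => laurentMonomial K (fun i => A i j)

/-- The toric ideal `I_A`, the kernel of `π`. -/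
def toricIdeal (A : Matrix (Fin d) ι ℤ) : Ideal (MvPolynomial ι K) :=
  RingHom.ker (toricMap K A)

/-- The difference of monomials `X^u - X^v`; it is a binomial when `u ≠ v`. -/
def binomial (u v : ι →₀ ℕ) : MvPolynomial ι K := monomial u 1 - monomial v 1

/-- The support of the binomial `X^u - X^v`: the set of (indices of) variables that divide `X^u`
or `X^v`. -/
def binomialSupport (u v : ι →₀ ℕ) : Set ι := {j | u j ≠ 0} ∪ {j | v j ≠ 0}

/-- `X^u - X^v` is a circuit of `I_A`: it is an irreducible binomial in `I_A`, and no binomial in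
`I_A` has a support that is a proper subset of its support. (Irreducibility forces `u ≠ v`.) -/
def IsCircuit (A : Matrix (Fin d) ι ℤ) (u v : ι →₀ ℕ) : Prop :=
  binomial K u v ∈ toricIdeal K A ∧ Irreducible (binomial K u v) ∧
    ∀ u' v' : ι →₀ ℕ, u' ≠ v' → binomial K u' v' ∈ toricIdeal K A →
      ¬ binomialSupport u' v' ⊂ binomialSupport u v

/-- The circuits `X^u - X^v` of `I_A` such that at least one of `X^u`, `X^v` is squarefree. -/
def circuitsSomeSquarefree (A : Matrix (Fin d) ι ℤ) : Set (MvPolynomial ι K) :=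
  {f | ∃ u v : ι →₀ ℕ, f = binomial K u v ∧ IsCircuit K A u v ∧
    (Squarefree (monomial u (1 : K)) ∨ Squarefree (monomial v (1 : K)))}

/-- The circuits `X^u - X^v` of `I_A` such that both `X^u` and `X^v` are squarefree. -/
def circuitsBothSquarefree (A : Matrix (Fin d) ι ℤ) : Set (MvPolynomial ι K) :=
  {f | ∃ u v : ι →₀ ℕ, f = binomial K u v ∧ IsCircuit K A u v ∧
    Squarefree (monomial u (1 : K)) ∧ Squarefree (monomial v (1 : K))}

/-- The set of columns of the Veronese configuration `V_d^{(r)}`. -/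
def veroneseColumns (d r : ℕ) : Set (Fin d → ℤ) :=
  {a | (∀ i, 0 ≤ a i) ∧ ∑ i, a i = r}

/-- The set of columns of the squarefree Veronese configuration `SV_d^{(r)}`. -/
def squarefreeVeroneseColumns (d r : ℕ) : Set (Fin d → ℤ) :=
  {a | (∀ i, a i = 0 ∨ a i = 1) ∧ ∑ i, a i = r}

/-- The matrix whose columns are the elements of `S`, each occurring once. -/
def matrixOfColumns (S : Set (Fin d → ℤ)) : Matrix (Fin d) S ℤ :=
  Matrix.of fun i a => (a : Fin d → ℤ) i

/-- The Veronese configuration `V_d^{(r)}`. -/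
def veronese (d r : ℕ) : Matrix (Fin d) (veroneseColumns d r) ℤ :=
  matrixOfColumns (veroneseColumns d r)

/-- The squarefree Veronese configuration `SV_d^{(r)}`. -/
def squarefreeVeronese (d r : ℕ) : Matrix (Fin d) (squarefreeVeroneseColumns d r) ℤ :=
  matrixOfColumns (squarefreeVeroneseColumns d r)

end

end Toric

/-! A toric ideal is spanned by the binomials whose two monomials have equal multidegree. Here all
columns have coordinate sum `r`, so such monomials also have equal degree. By induction on degree
(`toricIdeal_le_of_common_variable`) it suffices to move both monomials, modulo circuits, to
monomials sharing a variable, and cancel it. The moves are quadrics `x_a x_b - x_c x_e` with `a + b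
= c + e`; they are circuits when this is the only linear relation among the columns up to scalars
(`isCircuit_pairExp`).

Squarefree case: columns are `r`-subsets, and a move exchanges an element of one subset for an
element of another. The target variable is a subset carrying the `r` largest coordinates of the
multidegree, so it is the same for both monomials.

Veronese, `r = 2`: columns are edges and loops `e_i + e_j`, and the moves re-pair the four endpoints
of two edges.

Veronese, `r ≥ 3`: let `x_m` be the variable of `(r - m) e_i + m e_j`. The only monomials with the
multidegree of `x_0 x_3` are `x_0 x_3` and `x_1 x_2`. Their difference is not a circuit, since `x_0
x_2 - x_1 ^ 2` has smaller support. So no monomial of a circuit divides `x_0 x_3`, and even the set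
of all circuits fails to generate. -/

namespace Toric

/-! ### Binomials of toric ideals and quadratic circuits -/

section General

variable {K : Type*} [Field K] {d : ℕ} {ι : Type*}

/-- The exponent vector of the image of the monomial `X^u` under `toricMap`. -/
noncomputable def multidegree (A : Matrix (Fin d) ι ℤ) : (ι →₀ ℕ) →+ (Fin d → ℤ) :=
  Finsupp.liftAddHom fun j => (multiplesHom (Fin d → ℤ)) fun i => A i j

lemma multidegree_single (A : Matrix (Fin d) ι ℤ) (j : ι) (n : ℕ) (i : Fin d) :
    multidegree A (Finsupp.single j n) i = n * A i j := by
  simp [multidegree]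

lemma multidegree_apply (A : Matrix (Fin d) ι ℤ) (u : ι →₀ ℕ) (i : Fin d) :
    multidegree A u i = ∑ j ∈ u.support, (u j : ℤ) * A i j := by
  simp [multidegree, Finsupp.sum, Finset.sum_apply]

lemma toricMap_monomial (A : Matrix (Fin d) ι ℤ) (u : ι →₀ ℕ) (k : K) :
    toricMap K A (monomial u k) = AddMonoidAlgebra.single (multidegree A u) k := by
  have h1 : ∀ u : ι →₀ ℕ,
      toricMap K A (monomial u 1) = AddMonoidAlgebra.single (multidegree A u) 1 := by
    intro u
    induction u using Finsupp.induction_linear with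
    | zero => rw [map_zero, ← C_apply, C_1, map_one, AddMonoidAlgebra.one_def]
    | add f g hf hg =>
      rw [← one_mul (1 : K), ← monomial_mul, map_mul, hf, hg, map_add,
        AddMonoidAlgebra.single_mul_single]
    | single j n =>
      rw [← X_pow_eq_monomial, map_pow, toricMap, aeval_X, laurentMonomial,
        AddMonoidAlgebra.single_pow, one_pow]
      congr 1
      ext i
      simp [multidegree_single]
  rw [← mul_one k, ← smul_eq_mul, ← smul_monomial, map_smul, h1, AddMonoidAlgebra.smul_single]

lemma binomial_mem_toricIdeal {A : Matrix (Fin d) ι ℤ} {u v : ι →₀ ℕ} :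
    binomial K u v ∈ toricIdeal K A ↔ multidegree A u = multidegree A v := by
  rw [toricIdeal, RingHom.mem_ker, binomial, map_sub, sub_eq_zero]
  change toricMap K A _ = toricMap K A _ ↔ _
  rw [toricMap_monomial, toricMap_monomial, AddMonoidAlgebra.single_left_inj one_ne_zero]

/-- Replacing each monomial by a fixed representative of its multidegree changes a polynomial by a
combination of binomials in `J`. The result depends only on the image under `toricMap`, so it is
zero on the kernel. -/
lemma toricIdeal_le {A : Matrix (Fin d) ι ℤ} {J : Ideal (MvPolynomial ι K)}
    (h : ∀ u v, multidegree A u = multidegree A v → binomial K u v ∈ J) :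
    toricIdeal K A ≤ J := by
  let s : (Fin d → ℤ) → (ι →₀ ℕ) := Function.invFun (multidegree A)
  let L : LaurentRing K d → MvPolynomial ι K := AddMonoidAlgebra.mapDomain s
  have key : ∀ f : MvPolynomial ι K, f - L (toricMap K A f) ∈ J := by
    intro f
    induction f using MvPolynomial.induction_on' with
    | monomial u a =>
      have h1 : L (toricMap K A (monomial u a)) = monomial (s (multidegree A u)) a := by
        rw [toricMap_monomial]
        exact AddMonoidAlgebra.mapDomain_single
      have h2 : multidegree A u = multidegree A (s (multidegree A u)) :=
        (Function.invFun_eq ⟨u, rfl⟩).symm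
      have h3 : (monomial u a : MvPolynomial ι K) - monomial (s (multidegree A u)) a =
          C a * binomial K u (s (multidegree A u)) := by
        simp [binomial, mul_sub, C_mul_monomial]
      rw [h1, h3]
      exact J.mul_mem_left _ (h _ _ h2)
    | add p q hp hq =>
      have h1 : L (toricMap K A (p + q)) = L (toricMap K A p) + L (toricMap K A q) := by
        rw [map_add]
        exact AddMonoidAlgebra.mapDomain_add _ _ _
      rw [h1, add_sub_add_comm]
      exact J.add_mem hp hq
  intro f hf
  have h0 : toricMap K A f = 0 := hf
  have := key f
  rw [h0] at this
  simpa [L] using this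

lemma binomial_add (u v w : ι →₀ ℕ) :
    binomial K (w + u) (w + v) = monomial w 1 * binomial K u v := by
  simp [binomial, mul_sub, monomial_mul]

lemma binomial_swap (u v : ι →₀ ℕ) : binomial K v u = - binomial K u v := by
  simp [binomial]

lemma binomial_self (u : ι →₀ ℕ) : binomial K u u = 0 := by
  simp [binomial]

lemma binomial_mem_trans {J : Ideal (MvPolynomial ι K)} {u v w : ι →₀ ℕ}
    (h₁ : binomial K u v ∈ J) (h₂ : binomial K v w ∈ J) : binomial K u w ∈ J := by
  have := J.add_mem h₁ h₂
  simpa [binomial] using this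

lemma binomial_mem_symm {J : Ideal (MvPolynomial ι K)} {u v : ι →₀ ℕ}
    (h : binomial K u v ∈ J) : binomial K v u ∈ J := by
  rw [binomial_swap]
  exact J.neg_mem h

lemma sum_multidegree {A : Matrix (Fin d) ι ℤ} {r : ℤ} (hA : ∀ j, ∑ i, A i j = r)
    (u : ι →₀ ℕ) : ∑ i, multidegree A u i = u.degree * r := by
  simp_rw [multidegree_apply]
  rw [Finset.sum_comm]
  simp_rw [← Finset.mul_sum, hA, ← Finset.sum_mul]
  rw [Finsupp.degree_apply, Nat.cast_sum]

lemma degree_eq_of_multidegree_eq {A : Matrix (Fin d) ι ℤ} {r : ℤ} (hr : r ≠ 0)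
    (hA : ∀ j, ∑ i, A i j = r) {u v : ι →₀ ℕ} (h : multidegree A u = multidegree A v) :
    u.degree = v.degree := by
  have := sum_multidegree hA u
  rw [h, sum_multidegree hA v] at this
  exact_mod_cast (mul_right_cancel₀ hr this).symm

/-- To generate a homogeneous toric ideal it is enough that any two nonzero monomials of the same
multidegree can be moved, modulo the ideal, to monomials with a common variable. -/
lemma toricIdeal_le_of_common_variable {A : Matrix (Fin d) ι ℤ} {r : ℤ} (hr : r ≠ 0)
    (hA : ∀ j, ∑ i, A i j = r) {J : Ideal (MvPolynomial ι K)} (hJ : J ≤ toricIdeal K A)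
    (h : ∀ u v, u ≠ 0 → v ≠ 0 → multidegree A u = multidegree A v → ∃ c u' v',
      binomial K u (Finsupp.single c 1 + u') ∈ J ∧ binomial K v (Finsupp.single c 1 + v') ∈ J) :
    toricIdeal K A ≤ J := by
  apply toricIdeal_le
  have main : ∀ n : ℕ, ∀ u v : ι →₀ ℕ, u.degree = n → multidegree A u = multidegree A v →
      binomial K u v ∈ J := by
    intro n
    induction n with
    | zero =>
      intro u v hu huv
      have hv := degree_eq_of_multidegree_eq hr hA huv
      rw [hu, eq_comm, Finsupp.degree_eq_zero_iff] at hv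
      rw [Finsupp.degree_eq_zero_iff] at hu
      rw [hu, hv, binomial_self]
      exact J.zero_mem
    | succ n ih =>
      intro u v hu huv
      have hv := degree_eq_of_multidegree_eq hr hA huv
      obtain ⟨c, u', v', h1, h2⟩ := h u v (by rintro rfl; simp at hu)
        (by rintro rfl; simp [hu] at hv) huv
      have e1 := binomial_mem_toricIdeal.1 (hJ h1)
      have e2 := binomial_mem_toricIdeal.1 (hJ h2)
      have hdeg := degree_eq_of_multidegree_eq hr hA e1
      rw [hu, map_add, Finsupp.degree_single] at hdeg
      have h3 : binomial K u' v' ∈ J := by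
        refine ih u' v' (by omega) ?_
        rw [e1, e2, map_add, map_add] at huv
        exact add_left_cancel huv
      refine binomial_mem_trans h1 (binomial_mem_trans ?_ (binomial_mem_symm h2))
      rw [binomial_add]
      exact J.mul_mem_left _ h3
  exact fun u v huv => main _ u v rfl huv

/-- The exponent vector of the monomial `x_a x_b`. -/
noncomputable def pairExp (a b : ι) : ι →₀ ℕ := Finsupp.single a 1 + Finsupp.single b 1

lemma monomial_pairExp (a b : ι) : monomial (pairExp a b) (1 : K) = X a * X b := by
  simp [pairExp, X, monomial_mul]

lemma multidegree_pairExp (A : Matrix (Fin d) ι ℤ) (a b : ι) (i : Fin d) :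
    multidegree A (pairExp a b) i = A i a + A i b := by
  simp [pairExp, multidegree_single]

lemma pairExp_comm (a b : ι) : pairExp a b = pairExp b a := add_comm _ _

lemma not_X_dvd_X {a b : ι} (h : a ≠ b) : ¬ (X a : MvPolynomial ι K) ∣ X b := by
  rw [X_dvd_X]; exact h

lemma isRelPrime_X_X {a b : ι} (h : a ≠ b) : IsRelPrime (X a : MvPolynomial ι K) (X b) :=
  (X_prime.irreducible.isRelPrime_iff_not_dvd).2 (not_X_dvd_X h)

lemma squarefree_pairExp {a b : ι} (h : a ≠ b) :
    Squarefree (monomial (pairExp a b) (1 : K)) := by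
  rw [monomial_pairExp, squarefree_mul_iff]
  exact ⟨isRelPrime_X_X h, X_prime.irreducible.squarefree, X_prime.irreducible.squarefree⟩

/-- The binomial is linear in `X a` with coprime coefficients `X b` and `X c * X e`. The case `c =
e` is allowed. -/
lemma irreducible_binomial_pairExp {a b c e : ι} (hab : a ≠ b) (hac : a ≠ c) (hae : a ≠ e)
    (hbc : b ≠ c) (hbe : b ≠ e) : Irreducible (binomial K (pairExp a b) (pairExp c e)) := by
  have := irreducible_mul_X_add (X b : MvPolynomial ι K) (-(X c * X e)) a (X_ne_zero b)
    (by simp [vars_X, hab]) (by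
      classical
      rw [vars_neg]
      intro h
      have := vars_mul _ _ h
      simp [vars_X, hac, hae] at this)
    (((isRelPrime_X_X hbc).mul_right (isRelPrime_X_X hbe)).neg_right)
  rw [binomial, monomial_pairExp, monomial_pairExp]
  convert this using 1
  ring

/-- By `hrel`, every relation on these columns is a multiple of `a + b - c - e`, so a nonzero one
involves all of them and no binomial can have smaller support. When `c = e` only the sum `s + t` has
a meaning. -/
lemma isCircuit_pairExp {A : Matrix (Fin d) ι ℤ} {a b c e : ι} (hab : a ≠ b) (hac : a ≠ c)
    (hae : a ≠ e) (hbc : b ≠ c) (hbe : b ≠ e) (hsum : ∀ i, A i a + A i b = A i c + A i e)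
    (hrel : ∀ p q s t : ℤ, (∀ i, p * A i a + q * A i b + s * A i c + t * A i e = 0) →
      q = p ∧ s + t = -(2 * p) ∧ (c ≠ e → s = t)) :
    IsCircuit K A (pairExp a b) (pairExp c e) := by
  classical
  refine ⟨binomial_mem_toricIdeal.2 ?_, irreducible_binomial_pairExp hab hac hae hbc hbe, ?_⟩
  · ext i
    simp [multidegree_pairExp, hsum]
  intro u v huv hmem hss
  have hdeg := binomial_mem_toricIdeal.1 hmem
  have hsupp : ∀ j, j ∉ ({a, b, c, e} : Finset ι) → u j = 0 ∧ v j = 0 := by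
    intro j hj
    simp only [Finset.mem_insert, Finset.mem_singleton, not_or] at hj
    have h1 : j ∉ binomialSupport (pairExp a b) (pairExp c e) := by
      simp only [binomialSupport, pairExp, Set.mem_union, Set.mem_ofPred_eq, not_or, not_not]
      simp [Ne.symm hj.1, Ne.symm hj.2.1, Ne.symm hj.2.2.1,
        Ne.symm hj.2.2.2]
    have h2 : j ∉ binomialSupport u v := fun h => h1 (hss.1 h)
    simpa [binomialSupport] using h2
  have hval : ∀ i, ∑ j ∈ ({a, b, c, e} : Finset ι), ((u j : ℤ) - v j) * A i j = 0 := by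
    intro i
    have hu : multidegree A u i = ∑ j ∈ ({a, b, c, e} : Finset ι), (u j : ℤ) * A i j := by
      rw [multidegree_apply]
      refine Finset.sum_subset (fun j hj => ?_) (fun j _ hj => ?_)
      · by_contra h
        exact (Finsupp.mem_support_iff.1 hj) (hsupp j h).1
      · simp [Finsupp.notMem_support_iff.1 hj]
    have hv : multidegree A v i = ∑ j ∈ ({a, b, c, e} : Finset ι), (v j : ℤ) * A i j := by
      rw [multidegree_apply]
      refine Finset.sum_subset (fun j hj => ?_) (fun j _ hj => ?_)
      · by_contra h
        exact (Finsupp.mem_support_iff.1 hj) (hsupp j h).2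
      · simp [Finsupp.notMem_support_iff.1 hj]
    simp_rw [sub_mul, Finset.sum_sub_distrib]
    rw [← hu, ← hv, hdeg, sub_self]
  have hfin : ∀ w : ι → ℤ, (w = fun j => (u j : ℤ) - v j) → w b = w a ∧ (w a = 0 → w c = 0) ∧
      (w a = 0 → w e = 0) ∧ (w c = 0 → w a = 0) ∧ (w e = 0 → w a = 0) := by
    rintro w rfl
    by_cases hce : c = e
    · subst hce
      have := hrel ((u a : ℤ) - v a) ((u b : ℤ) - v b) ((u c : ℤ) - v c) 0 (fun i => by
        have := hval i
        rw [Finset.sum_insert (by simp [*]), Finset.sum_insert (by simp [*])] at this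
        simp at this
        linarith)
      grind
    · have := hrel ((u a : ℤ) - v a) ((u b : ℤ) - v b) ((u c : ℤ) - v c) ((u e : ℤ) - v e)
        (fun i => by
        have := hval i
        rw [Finset.sum_insert (by simp [*]), Finset.sum_insert (by simp [*]),
          Finset.sum_insert (by simp [*]), Finset.sum_singleton] at this
        linarith)
      grind
  obtain ⟨h1, h2, h3, h4, h5⟩ := hfin _ rfl
  simp only [sub_eq_zero] at h1 h2 h3 h4 h5
  by_cases h0 : u a = v a
  · apply huv
    ext j
    by_cases hj : j ∈ ({a, b, c, e} : Finset ι)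
    · simp only [Finset.mem_insert, Finset.mem_singleton] at hj
      rcases hj with rfl | rfl | rfl | rfl
      · exact h0
      · omega
      · have := h2 (by omega); omega
      · have := h3 (by omega); omega
    · rw [(hsupp j hj).1, (hsupp j hj).2]
  -- A nonzero multiple of the relation is nonzero at every one of the columns, so the two supports
  -- coincide.
  · apply hss.2
    intro j hj
    have hne : u j ≠ v j := by
      have hj' : j ∈ ({a, b, c, e} : Finset ι) := by
        by_contra hj'
        simp only [Finset.mem_insert, Finset.mem_singleton, not_or] at hj'
        simp [binomialSupport, pairExp, Finsupp.single_apply, Ne.symm hj'.1, Ne.symm hj'.2.1,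
          Ne.symm hj'.2.2.1, Ne.symm hj'.2.2.2] at hj
      simp only [Finset.mem_insert, Finset.mem_singleton] at hj'
      rcases hj' with rfl | rfl | rfl | rfl
      · exact h0
      · omega
      · intro h; apply h0; have := h4 (by omega); omega
      · intro h; apply h0; have := h5 (by omega); omega
    simp only [binomialSupport, Set.mem_union, Set.mem_ofPred_eq]
    omega

end General


/-! ### Splitting off one or two variables from a monomial -/

section Exchange

variable {K : Type*} [Field K] {ι : Type*}

lemma exists_eq_add_pairExp {u : ι →₀ ℕ} {a b : ι} (hab : a ≠ b) (ha : u a ≠ 0) (hb : u b ≠ 0) :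
    ∃ w, u = pairExp a b + w := by
  classical
  apply exists_add_of_le
  intro j
  simp only [pairExp, Finsupp.add_apply, Finsupp.single_apply]
  grind

lemma exists_eq_add_single {u : ι →₀ ℕ} {a : ι} (ha : u a ≠ 0) :
    ∃ w, u = Finsupp.single a 1 + w := by
  classical
  apply exists_add_of_le
  intro j
  simp only [Finsupp.single_apply]
  grind

lemma binomial_add_mem {J : Ideal (MvPolynomial ι K)} {u v : ι →₀ ℕ} (h : binomial K u v ∈ J)
    (w : ι →₀ ℕ) : binomial K (u + w) (v + w) ∈ J := by
  rw [add_comm u, add_comm v, binomial_add]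
  exact J.mul_mem_left _ h

end Exchange

/-! ### The squarefree Veronese configuration -/

section SquarefreeVeronese

variable {K : Type*} [Field K] {d r : ℕ}

lemma circuitsBothSquarefree_subset {ι : Type*} (A : Matrix (Fin d) ι ℤ) :
    Ideal.span (circuitsBothSquarefree K A) ≤ toricIdeal K A := by
  rw [Ideal.span_le]
  rintro _ ⟨u, v, rfl, h, -⟩
  exact h.1

lemma circuitsSomeSquarefree_subset {ι : Type*} (A : Matrix (Fin d) ι ℤ) :
    Ideal.span (circuitsSomeSquarefree K A) ≤ toricIdeal K A := by
  rw [Ideal.span_le]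
  rintro _ ⟨u, v, rfl, h, -⟩
  exact h.1

/-- The vector obtained from `b` by replacing the coordinate vector `e_k` by `e_i`. -/
def swapVec (b : Fin d → ℤ) (i k : Fin d) : Fin d → ℤ := b + Pi.single i 1 - Pi.single k 1

lemma swapVec_apply (b : Fin d → ℤ) (i k j : Fin d) :
    swapVec b i k j = b j + (if j = i then 1 else 0) - (if j = k then 1 else 0) := by
  simp [swapVec, Pi.single_apply]

lemma swapVec_mem {b : Fin d → ℤ} (hb : b ∈ squarefreeVeroneseColumns d r) {i k : Fin d}
    (hi : b i = 0) (hk : b k = 1) : swapVec b i k ∈ squarefreeVeroneseColumns d r := by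
  constructor
  · intro j
    have := hb.1 j
    rw [swapVec_apply]
    grind
  · simp [swapVec, Finset.sum_add_distrib, hb.2]

/-- If `b` and `b'` agree away from `i` and `k`, the exchange merely interchanges them and the
binomial is zero. Otherwise they differ at some further `l`, and the coordinates `i`, `k`, `l` leave
only the relation `b + b' = c + c'`. -/
lemma binomial_swapVec_mem (b b' : squarefreeVeroneseColumns d r) {i k : Fin d}
    (hi : b.1 i = 0) (hk : b.1 k = 1) (hi' : b'.1 i = 1) (hk' : b'.1 k = 0) :
    binomial K (pairExp b b') (pairExp ⟨swapVec b.1 i k, swapVec_mem b.2 hi hk⟩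
      ⟨swapVec b'.1 k i, swapVec_mem b'.2 hk' hi'⟩) ∈
      Ideal.span (circuitsBothSquarefree K (squarefreeVeronese d r)) := by
  have hik : i ≠ k := by rintro rfl; omega
  by_cases h : ∀ l, l ≠ i → l ≠ k → b.1 l = b'.1 l
  · have e1 : (⟨swapVec b.1 i k, swapVec_mem b.2 hi hk⟩ : squarefreeVeroneseColumns d r) = b' := by
      ext j
      have := h j
      simp only [swapVec_apply]
      grind
    have e2 : (⟨swapVec b'.1 k i, swapVec_mem b'.2 hk' hi'⟩ : squarefreeVeroneseColumns d r) = b := by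
      ext j
      have := h j
      simp only [swapVec_apply]
      grind
    rw [e1, e2, pairExp_comm, binomial_self]
    exact Ideal.zero_mem _
  · push Not at h
    obtain ⟨l, hli, hlk, hl⟩ := h
    have hbl := b.2.1 l
    have hbl' := b'.2.1 l
    set c : squarefreeVeroneseColumns d r := ⟨swapVec b.1 i k, swapVec_mem b.2 hi hk⟩ with hc
    set c' : squarefreeVeroneseColumns d r := ⟨swapVec b'.1 k i, swapVec_mem b'.2 hk' hi'⟩ with hc'
    have hcv : ∀ j, c.1 j = b.1 j + (if j = i then 1 else 0) - (if j = k then 1 else 0) :=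
      swapVec_apply _ _ _
    have hcv' : ∀ j, c'.1 j = b'.1 j + (if j = k then 1 else 0) - (if j = i then 1 else 0) :=
      swapVec_apply _ _ _
    clear_value c c'
    have hci := hcv i
    have hck := hcv k
    have hcl := hcv l
    have hci' := hcv' i
    have hck' := hcv' k
    have hcl' := hcv' l
    simp only [hik, hik.symm, hli, hlk, if_true, if_false] at hci hck hcl hci' hck' hcl'
    have hbb' : b ≠ b' := by rintro rfl; exact hl rfl
    have hcc' : c ≠ c' := by rintro rfl; omega
    apply Ideal.subset_span
    refine ⟨_, _, rfl, isCircuit_pairExp hbb' ?_ ?_ ?_ ?_ ?_ ?_, squarefree_pairExp hbb',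
      squarefree_pairExp hcc'⟩
    · rintro rfl; omega
    · rintro rfl; omega
    · rintro rfl; omega
    · rintro rfl; omega
    · intro j
      change b.1 j + b'.1 j = c.1 j + c'.1 j
      rw [hcv, hcv']
      ring
    · intro p q s t H
      have H' : ∀ j, p * b.1 j + q * b'.1 j + s * c.1 j + t * c'.1 j = 0 := H
      have h1 := H' i
      have h2 := H' k
      have h3 := H' l
      rw [hci, hci', hi, hi'] at h1
      rw [hck, hck', hk, hk'] at h2
      rw [hcl, hcl'] at h3
      rcases hbl with hbl | hbl <;> rcases hbl' with hbl' | hbl' <;> rw [hbl, hbl'] at h3 hl <;>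
        first | exact absurd rfl hl | (refine ⟨?_, ?_, fun _ => ?_⟩ <;> linarith)

/-- Double counting: if every column of `u` containing `i` also contained `k`, then `b`, which
contains only `k`, would make the `k`-th coordinate of the multidegree strictly larger. -/
lemma exists_exchange_partner {u : squarefreeVeroneseColumns d r →₀ ℕ}
    {b : squarefreeVeroneseColumns d r} (hb : u b ≠ 0) {i k : Fin d}
    (hi : b.1 i = 0) (hk : b.1 k = 1)
    (hle : multidegree (squarefreeVeronese d r) u k ≤ multidegree (squarefreeVeronese d r) u i) :
    ∃ b' : squarefreeVeroneseColumns d r, u b' ≠ 0 ∧ b'.1 i = 1 ∧ b'.1 k = 0 := by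
  by_contra! hcon
  rw [multidegree_apply, multidegree_apply] at hle
  refine absurd hle (not_le.2 (Finset.sum_lt_sum (fun j hj => ?_) ⟨b, by simpa using hb, ?_⟩))
  · have h1 := hcon j (by simpa using hj)
    have h2 := j.2.1 i
    have h3 := j.2.1 k
    refine mul_le_mul_of_nonneg_left ?_ (by positivity)
    change j.1 i ≤ j.1 k
    grind
  · change (u b : ℤ) * b.1 i < u b * b.1 k
    rw [hi, hk]
    simpa [Nat.pos_iff_ne_zero] using hb

/-- Induction on the number of coordinates where `b` and `c` differ. An exchange corrects `b` at `i`
and `k` and preserves the multidegree, hence also the domination hypothesis. -/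
lemma exists_binomial_single_add_mem (c : squarefreeVeroneseColumns d r) (n : ℕ) :
    ∀ (u : squarefreeVeroneseColumns d r →₀ ℕ) (b : squarefreeVeroneseColumns d r), u b ≠ 0 →
      (∀ i k, c.1 i = 1 → c.1 k = 0 →
        multidegree (squarefreeVeronese d r) u k ≤ multidegree (squarefreeVeronese d r) u i) →
      (Finset.univ.filter fun j => b.1 j ≠ c.1 j).card = n →
      ∃ u', binomial K u (Finsupp.single c 1 + u') ∈
        Ideal.span (circuitsBothSquarefree K (squarefreeVeronese d r)) := by
  induction n using Nat.strong_induction_on with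
  | _ n ih =>
    intro u b hb hdom hn
    by_cases hbc : b = c
    · subst hbc
      obtain ⟨w, rfl⟩ := exists_eq_add_single hb
      exact ⟨w, by rw [binomial_self]; exact Ideal.zero_mem _⟩
    have hex : (∃ i, b.1 i < c.1 i) ∧ ∃ k, c.1 k < b.1 k := by
      have hsum : ∑ i, b.1 i = ∑ i, c.1 i := b.2.2.trans c.2.2.symm
      constructor
      · by_contra! hle
        apply hbc
        ext j
        exact ((Finset.sum_eq_sum_iff_of_le fun i _ => hle i).1 hsum.symm j (Finset.mem_univ j)).symm
      · by_contra! hle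
        apply hbc
        ext j
        exact (Finset.sum_eq_sum_iff_of_le fun i _ => hle i).1 hsum j (Finset.mem_univ j)
    obtain ⟨⟨i, hi⟩, k, hk⟩ := hex
    have hbi := b.2.1 i
    have hci := c.2.1 i
    have hbk := b.2.1 k
    have hck := c.2.1 k
    have hbi0 : b.1 i = 0 := by omega
    have hci1 : c.1 i = 1 := by omega
    have hbk1 : b.1 k = 1 := by omega
    have hck0 : c.1 k = 0 := by omega
    obtain ⟨b', hb', hi', hk'⟩ := exists_exchange_partner hb hbi0 hbk1 (hdom i k hci1 hck0)
    obtain ⟨w, rfl⟩ := exists_eq_add_pairExp (by rintro rfl; omega) hb hb'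
    have hmem := binomial_add_mem
      (binomial_swapVec_mem (K := K) b b' hbi0 hbk1 hi' hk') w
    have hdeg := binomial_mem_toricIdeal.1 (circuitsBothSquarefree_subset _ hmem)
    have hlt : (Finset.univ.filter fun j => swapVec b.1 i k j ≠ c.1 j).card < n := by
      rw [← hn]
      apply Finset.card_lt_card
      rw [Finset.ssubset_iff_of_subset]
      · refine ⟨i, by simp [hbi0, hci1], ?_⟩
        have hik : i ≠ k := by rintro rfl; omega
        simp [swapVec_apply, hik, hbi0, hci1]
      · intro j
        simp only [Finset.mem_filter, Finset.mem_univ, true_and, swapVec_apply]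
        grind
    obtain ⟨u', hu'⟩ := ih _ hlt _ ⟨swapVec b.1 i k, swapVec_mem b.2 hbi0 hbk1⟩
      (by simp [pairExp]) (hdeg ▸ hdom) rfl
    exact ⟨u', binomial_mem_trans hmem hu'⟩

lemma finite_squarefreeVeroneseColumns (d r : ℕ) : (squarefreeVeroneseColumns d r).Finite := by
  refine (Set.Finite.pi' (t := fun _ : Fin d => ({0, 1} : Set ℤ)) fun _ => by simp).subset ?_
  intro a ha i
  simpa using ha.1 i

/-- Take `c` maximizing the pairing with `D`: exchanging `i` for `k` changes it by `D k - D i`. The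
column `b` serves only to make the set nonempty. -/
lemma exists_dominating_column (b : squarefreeVeroneseColumns d r) (D : Fin d → ℤ) :
    ∃ c : squarefreeVeroneseColumns d r, ∀ i k, c.1 i = 1 → c.1 k = 0 → D k ≤ D i := by
  obtain ⟨c, hc, hmax⟩ := (finite_squarefreeVeroneseColumns d r).exists_maximalFor
    (fun a => ∑ j, D j * a j) _ ⟨b.1, b.2⟩
  refine ⟨⟨c, hc⟩, fun i k hi hk => ?_⟩
  by_contra! hlt
  have hval : ∑ j, D j * swapVec c k i j = ∑ j, D j * c j + D k - D i := by
    simp [swapVec, mul_sub, mul_add, Finset.sum_add_distrib, Pi.single_apply]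
  have := hmax (swapVec_mem hc hk hi) (by simp only [hval]; linarith)
  simp only [hval] at this
  linarith

theorem toricIdeal_squarefreeVeronese (hr : r ≠ 0) :
    toricIdeal K (squarefreeVeronese d r) =
      Ideal.span (circuitsBothSquarefree K (squarefreeVeronese d r)) := by
  refine le_antisymm ?_ (circuitsBothSquarefree_subset _)
  refine toricIdeal_le_of_common_variable (r := (r : ℤ)) (by exact_mod_cast hr) (fun j => j.2.2)
    (circuitsBothSquarefree_subset _) ?_
  intro u v hu hv huv
  obtain ⟨a, ha⟩ := Finsupp.ne_iff.1 hu
  obtain ⟨b, hb⟩ := Finsupp.ne_iff.1 hv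
  obtain ⟨c, hc⟩ := exists_dominating_column a (multidegree (squarefreeVeronese d r) u)
  obtain ⟨u', hu'⟩ := exists_binomial_single_add_mem (K := K) c _ u a ha hc rfl
  obtain ⟨v', hv'⟩ := exists_binomial_single_add_mem (K := K) c _ v b hb (huv ▸ hc) rfl
  exact ⟨c, u', v', hu', hv'⟩

end SquarefreeVeronese


/-! ### The second Veronese configuration -/

section VeroneseTwo

variable {K : Type*} [Field K] {d : ℕ}

/-- The column `e_i + e_j` of the second Veronese configuration. -/
def edgeColumn (i j : Fin d) : veroneseColumns d 2 :=
  ⟨Pi.single i 1 + Pi.single j 1, by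
    refine ⟨fun k => ?_, by simp [Finset.sum_add_distrib]⟩
    simp only [Pi.add_apply, Pi.single_apply]
    grind⟩

lemma edgeColumn_apply (i j k : Fin d) :
    (edgeColumn i j).1 k = (if k = i then 1 else 0) + (if k = j then 1 else 0) := by
  simp [edgeColumn, Pi.single_apply]

lemma edgeColumn_comm (i j : Fin d) : edgeColumn i j = edgeColumn j i := by
  simp [edgeColumn, add_comm]

lemma edgeColumn_eq_iff {i j k l : Fin d} :
    edgeColumn i j = edgeColumn k l ↔ (i = k ∧ j = l) ∨ (i = l ∧ j = k) := by
  constructor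
  · intro h
    have h1 := congrArg (fun a => a.1 i) h
    have h2 := congrArg (fun a => a.1 j) h
    have h3 := congrArg (fun a => a.1 k) h
    have h4 := congrArg (fun a => a.1 l) h
    simp only [edgeColumn_apply] at h1 h2 h3 h4
    grind
  · rintro (⟨rfl, rfl⟩ | ⟨rfl, rfl⟩)
    · rfl
    · exact edgeColumn_comm _ _

lemma exists_eq_edgeColumn (a : veroneseColumns d 2) {i : Fin d} (hi : a.1 i ≠ 0) :
    ∃ j, a = edgeColumn i j := by
  obtain ⟨a, hnn, hsum⟩ := a
  have hi1 : 1 ≤ a i := by have := hnn i; simp only at hi; omega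
  set b : Fin d → ℤ := a - Pi.single i 1 with hb
  have hbnn : ∀ j, 0 ≤ b j := by
    intro j
    have := hnn j
    simp only [hb, Pi.sub_apply, Pi.single_apply]
    grind
  have hbsum : ∑ j, b j = 1 := by simp [hb, hsum]
  obtain ⟨j, -, hj⟩ := Finset.exists_ne_zero_of_sum_ne_zero (by rw [hbsum]; exact one_ne_zero)
  refine ⟨j, Subtype.ext ?_⟩
  -- Here `b` is nonnegative of sum one; removing a unit vector from its support leaves a
  -- nonnegative vector of sum zero.
  have hcnn : ∀ k ∈ Finset.univ, 0 ≤ (b - Pi.single j (1 : ℤ) : Fin d → ℤ) k := by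
    intro k _
    have h1 := hbnn k
    have h2 := hbnn j
    simp only [Pi.sub_apply, Pi.single_apply]
    grind
  have hc := (Finset.sum_eq_zero_iff_of_nonneg hcnn).1 (by simp [hbsum])
  ext k
  have := hc k (Finset.mem_univ k)
  simp only [hb, Pi.sub_apply] at this
  simp only [edgeColumn, Pi.add_apply]
  linarith

lemma binomial_edgeColumn_mem_of_ne {i j k l : Fin d} (hkj : k ≠ j) (hil : i ≠ l)
    (hne : edgeColumn i k ≠ edgeColumn j l) :
    binomial K (pairExp (edgeColumn i k) (edgeColumn j l))
      (pairExp (edgeColumn i j) (edgeColumn k l)) ∈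
        Ideal.span (circuitsSomeSquarefree K (veronese d 2)) := by
  apply Ideal.subset_span
  refine ⟨_, _, rfl, isCircuit_pairExp hne ?_ ?_ ?_ ?_ ?_ ?_, Or.inl (squarefree_pairExp hne)⟩
  · rw [Ne, edgeColumn_eq_iff]; grind
  · rw [Ne, edgeColumn_eq_iff]; grind
  · rw [Ne, edgeColumn_eq_iff]; grind
  · rw [Ne, edgeColumn_eq_iff]; grind
  · intro m
    change (edgeColumn i k).1 m + (edgeColumn j l).1 m = (edgeColumn i j).1 m + (edgeColumn k l).1 m
    simp only [edgeColumn_apply]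
    ring
  · intro p q s t H
    have H' : ∀ m, p * (edgeColumn i k).1 m + q * (edgeColumn j l).1 m +
      s * (edgeColumn i j).1 m + t * (edgeColumn k l).1 m = 0 := H
    rw [Ne, edgeColumn_eq_iff] at hne
    rw [Ne, edgeColumn_eq_iff]
    have h1 := H' i
    have h2 := H' j
    have h3 := H' k
    have h4 := H' l
    simp only [edgeColumn_apply] at h1 h2 h3 h4
    clear H H'
    -- These are the only coincidences of indices left open by `hkj` and `hil`.
    by_cases hij : i = j <;> by_cases hik : i = k <;> by_cases hjl : j = l <;>
      by_cases hkl : k = l <;> grind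

lemma binomial_edgeColumn_mem (i j k l : Fin d) :
    binomial K (pairExp (edgeColumn i k) (edgeColumn j l))
      (pairExp (edgeColumn i j) (edgeColumn k l)) ∈
        Ideal.span (circuitsSomeSquarefree K (veronese d 2)) := by
  by_cases hkj : k = j
  · subst hkj
    rw [binomial_self]
    exact Ideal.zero_mem _
  by_cases hil : i = l
  · subst hil
    rw [edgeColumn_comm i k, edgeColumn_comm j i, pairExp_comm, binomial_self]
    exact Ideal.zero_mem _
  -- In the equal case the binomial is `x_ik ^ 2 - x_ii x_kk`, and its second monomial is the
  -- squarefree one, so the move is read backwards.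
  by_cases hne : edgeColumn i k = edgeColumn j l
  · apply binomial_mem_symm
    refine binomial_edgeColumn_mem_of_ne (Ne.symm hkj) hil ?_
    rw [edgeColumn_eq_iff] at hne
    rw [Ne, edgeColumn_eq_iff]
    grind
  · exact binomial_edgeColumn_mem_of_ne hkj hil hne

lemma exists_column_of_multidegree_ne_zero {ι : Type*} {A : Matrix (Fin d) ι ℤ} {u : ι →₀ ℕ}
    {i : Fin d} (h : multidegree A u i ≠ 0) : ∃ a, u a ≠ 0 ∧ A i a ≠ 0 := by
  rw [multidegree_apply] at h
  obtain ⟨a, ha, h⟩ := Finset.exists_ne_zero_of_sum_ne_zero h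
  exact ⟨a, by simpa using ha, right_ne_zero_of_mul h⟩

lemma multidegree_veronese_nonneg {r : ℕ} (u : veroneseColumns d r →₀ ℕ) (i : Fin d) :
    0 ≤ multidegree (veronese d r) u i := by
  rw [multidegree_apply]
  exact Finset.sum_nonneg fun a _ => mul_nonneg (by positivity) (a.2.1 i)

/-- If the multidegree of `X^u` is at least `e_i + e_j`, then `X^u` is congruent to a multiple of
the variable indexed by `e_i + e_j`. -/
lemma exists_binomial_edgeColumn_add_mem {u : veroneseColumns d 2 →₀ ℕ} {i j : Fin d}
    (h : ∀ m, (edgeColumn i j).1 m ≤ multidegree (veronese d 2) u m) :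
    ∃ u', binomial K u (Finsupp.single (edgeColumn i j) 1 + u') ∈
      Ideal.span (circuitsSomeSquarefree K (veronese d 2)) := by
  have hi := h i
  have hj := h j
  simp only [edgeColumn_apply] at hi hj
  obtain ⟨a, ha, hai⟩ := exists_column_of_multidegree_ne_zero (A := veronese d 2) (u := u) (i := i)
    (by grind)
  obtain ⟨k, rfl⟩ := exists_eq_edgeColumn a hai
  by_cases hkj : k = j
  · subst hkj
    obtain ⟨w, rfl⟩ := exists_eq_add_single ha
    exact ⟨w, by rw [binomial_self]; exact Ideal.zero_mem _⟩
  obtain ⟨w, rfl⟩ := exists_eq_add_single ha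
  -- The removed edge uses up `j` only if `i = j`, and then once, as `k ≠ j`; but in that case `h`
  -- gives multidegree at least two at `j`.
  have hw : multidegree (veronese d 2) w j ≠ 0 := by
    have hv : (veronese d 2) j (edgeColumn i k) = (edgeColumn i k).1 j := rfl
    rw [map_add, Pi.add_apply, multidegree_single, hv, edgeColumn_apply] at hj
    grind
  obtain ⟨b, hb, hbj⟩ := exists_column_of_multidegree_ne_zero hw
  obtain ⟨l, rfl⟩ := exists_eq_edgeColumn b hbj
  obtain ⟨w', rfl⟩ := exists_eq_add_single hb
  refine ⟨Finsupp.single (edgeColumn k l) 1 + w', ?_⟩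
  rw [← add_assoc, ← add_assoc]
  exact binomial_add_mem (binomial_edgeColumn_mem i j k l) w'

theorem toricIdeal_veronese_two :
    toricIdeal K (veronese d 2) = Ideal.span (circuitsSomeSquarefree K (veronese d 2)) := by
  refine le_antisymm ?_ (circuitsSomeSquarefree_subset _)
  refine toricIdeal_le_of_common_variable (r := 2) (by norm_num) (fun j => j.2.2)
    (circuitsSomeSquarefree_subset _) ?_
  intro u v _ hv huv
  obtain ⟨c, hc⟩ := Finsupp.ne_iff.1 hv
  obtain ⟨v', rfl⟩ := exists_eq_add_single hc
  obtain ⟨i, -, hi⟩ := Finset.exists_ne_zero_of_sum_ne_zero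
    (show ∑ i, c.1 i ≠ 0 by rw [c.2.2]; norm_num)
  obtain ⟨j, rfl⟩ := exists_eq_edgeColumn c hi
  obtain ⟨u', hu'⟩ := exists_binomial_edgeColumn_add_mem (K := K) (u := u) (i := i) (j := j) (by
    intro m
    rw [huv, map_add, Pi.add_apply, multidegree_single]
    have := multidegree_veronese_nonneg v' m
    simpa [veronese, matrixOfColumns] using this)
  exact ⟨_, u', v', hu', by rw [binomial_self]; exact Ideal.zero_mem _⟩

end VeroneseTwo

/-! ### Failure of generation for `r ≥ 3` -/

section VeroneseHigher

variable {K : Type*} [Field K] {d r : ℕ}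

/-- The column `(r - m) e_i + m e_j` of the Veronese configuration. -/
def lineColumn {i j : Fin d} (hij : i ≠ j) {m : ℕ} (hm : m ≤ r) : veroneseColumns d r :=
  ⟨Pi.single i ((r : ℤ) - m) + Pi.single j (m : ℤ), by
    refine ⟨fun k => ?_, by simp [Finset.sum_add_distrib]⟩
    simp only [Pi.add_apply, Pi.single_apply]
    grind⟩

lemma lineColumn_apply {i j : Fin d} (hij : i ≠ j) {m : ℕ} (hm : m ≤ r) (k : Fin d) :
    (lineColumn hij hm).1 k = (if k = i then (r : ℤ) - m else 0) + (if k = j then (m : ℤ) else 0) := by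
  simp [lineColumn, Pi.single_apply]

lemma lineColumn_right {i j : Fin d} (hij : i ≠ j) {m : ℕ} (hm : m ≤ r) :
    (lineColumn hij hm).1 j = m := by
  simp [lineColumn_apply, hij.symm]

lemma eq_lineColumn {i j : Fin d} (hij : i ≠ j) {m : ℕ} (hm : m ≤ r) {a : veroneseColumns d r}
    (h : ∀ k, k ≠ i → k ≠ j → a.1 k = 0) (hj : a.1 j = m) : a = lineColumn hij hm := by
  have hs : ∑ k, a.1 k = a.1 i + a.1 j := by
    rw [← Finset.sum_pair hij]
    refine (Finset.sum_subset (Finset.subset_univ _) fun k _ hk => ?_).symm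
    simp only [Finset.mem_insert, Finset.mem_singleton, not_or] at hk
    exact h k hk.1 hk.2
  rw [a.2.2] at hs
  ext k
  rw [lineColumn_apply]
  have := h k
  grind

/-- The exponent vectors of multidegree `(2r - 3) e_i + 3 e_j`. -/
lemma eq_pairExp_of_multidegree_eq {i j : Fin d} (hij : i ≠ j) (hr : 3 ≤ r)
    {v : veroneseColumns d r →₀ ℕ}
    (hv : multidegree (veronese d r)
      (pairExp (lineColumn hij (Nat.zero_le r)) (lineColumn hij hr)) =
      multidegree (veronese d r) v) :
    v = pairExp (lineColumn hij (Nat.zero_le r)) (lineColumn hij hr) ∨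
      v = pairExp (lineColumn hij (show 1 ≤ r by omega)) (lineColumn hij (show 2 ≤ r by omega)) := by
  have hdeg := degree_eq_of_multidegree_eq (r := (r : ℤ)) (by omega) (fun a => a.2.2) hv
  have hd1 : (pairExp (lineColumn hij (Nat.zero_le r)) (lineColumn hij hr)).degree = 2 := by
    simp [pairExp]
  rw [hd1] at hdeg
  obtain ⟨a, b, rfl⟩ : ∃ a b, v = pairExp a b := by
    obtain ⟨a, ha⟩ := Finsupp.ne_iff.1 (show v ≠ 0 by rintro rfl; simp at hdeg)
    obtain ⟨w, rfl⟩ := exists_eq_add_single ha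
    rw [map_add, Finsupp.degree_single] at hdeg
    obtain ⟨b, hb⟩ := Finsupp.ne_iff.1 (show w ≠ 0 by rintro rfl; simp at hdeg)
    obtain ⟨w, rfl⟩ := exists_eq_add_single hb
    rw [map_add, Finsupp.degree_single] at hdeg
    have hw : w = 0 := (Finsupp.degree_eq_zero_iff w).1 (by omega)
    exact ⟨a, b, by rw [hw, add_zero]; rfl⟩
  have hval : ∀ k, (lineColumn hij (Nat.zero_le r)).1 k + (lineColumn hij hr).1 k =
      a.1 k + b.1 k := by
    intro k
    have := congrFun hv k
    rw [multidegree_pairExp, multidegree_pairExp] at this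
    exact this
  have hoff : ∀ k, k ≠ i → k ≠ j → a.1 k = 0 ∧ b.1 k = 0 := by
    intro k hki hkj
    have h1 := hval k
    have h2 := a.2.1 k
    have h3 := b.2.1 k
    simp only [lineColumn_apply, hki, hkj, if_false] at h1
    omega
  have hj := hval j
  rw [lineColumn_right, lineColumn_right] at hj
  have ha := a.2.1 j
  have hb := b.2.1 j
  have hao := fun k hi hj => (hoff k hi hj).1
  have hbo := fun k hi hj => (hoff k hi hj).2
  -- Both columns live on `i` and `j`, so each is determined by its `j`-th entry; these entries are
  -- nonnegative with sum three.
  have hcases : a.1 j = 0 ∨ a.1 j = 1 ∨ a.1 j = 2 ∨ a.1 j = 3 := by push_cast at hj; omega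
  push_cast at hj
  rcases hcases with h | h | h | h
  · rw [eq_lineColumn hij (Nat.zero_le r) hao (by simpa using h),
      eq_lineColumn hij hr hbo (by push_cast; omega)]
    exact Or.inl rfl
  · rw [eq_lineColumn hij (show 1 ≤ r by omega) hao (by simpa using h),
      eq_lineColumn hij (show 2 ≤ r by omega) hbo (by push_cast; omega)]
    exact Or.inr rfl
  · rw [eq_lineColumn hij (show 2 ≤ r by omega) hao (by simpa using h),
      eq_lineColumn hij (show 1 ≤ r by omega) hbo (by push_cast; omega), pairExp_comm]
    exact Or.inr rfl
  · rw [eq_lineColumn hij hr hao (by simpa using h),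
      eq_lineColumn hij (Nat.zero_le r) hbo (by push_cast; omega), pairExp_comm]
    exact Or.inl rfl

lemma lineColumn_ne {i j : Fin d} (hij : i ≠ j) {m n : ℕ} (hm : m ≤ r) (hn : n ≤ r)
    (h : m ≠ n) : lineColumn hij hm ≠ lineColumn hij hn := by
  intro he
  have := congrArg (fun a => a.1 j) he
  simp only [lineColumn_right] at this
  exact h (by exact_mod_cast this)

/-- The columns `(r - m) e_i + m e_j` for `m = 0, 1, 2` support a binomial of the toric ideal, so
the quadric on `m = 0, 1, 2, 3` has no minimal support. -/
lemma exists_binomialSupport_ssubset {i j : Fin d} (hij : i ≠ j) (hr : 3 ≤ r)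
    {u v : veroneseColumns d r →₀ ℕ}
    (hS : ∀ m (hm : m ≤ r), m ≤ 3 → lineColumn hij hm ∈ binomialSupport u v) :
    ∃ u' v' : veroneseColumns d r →₀ ℕ, u' ≠ v' ∧
      binomial K u' v' ∈ toricIdeal K (veronese d r) ∧
      binomialSupport u' v' ⊂ binomialSupport u v := by
  classical
  have h1 : 1 ≤ r := by omega
  have h2 : 2 ≤ r := by omega
  have hmem : ∀ a, a ∈ binomialSupport (pairExp (lineColumn hij (Nat.zero_le r)) (lineColumn hij h2))
      (pairExp (lineColumn hij h1) (lineColumn hij h1)) → ∃ m, ∃ hm : m ≤ r, m ≤ 2 ∧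
        a = lineColumn hij hm := by
    intro a ha
    by_contra! hcon
    have e0 := hcon 0 (Nat.zero_le r) (by omega)
    have e1 := hcon 1 h1 (by omega)
    have e2 := hcon 2 h2 (by omega)
    simp [binomialSupport, pairExp, Ne.symm e0, Ne.symm e1, Ne.symm e2] at ha
  refine ⟨pairExp (lineColumn hij (Nat.zero_le r)) (lineColumn hij h2),
    pairExp (lineColumn hij h1) (lineColumn hij h1), ?_, ?_, ?_⟩
  · intro h
    have := DFunLike.congr_fun h (lineColumn hij (Nat.zero_le r))
    simp [pairExp, Finsupp.single_apply, lineColumn_ne hij h1 (Nat.zero_le r) one_ne_zero] at this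
  · rw [binomial_mem_toricIdeal]
    ext k
    rw [multidegree_pairExp, multidegree_pairExp]
    change (lineColumn hij (Nat.zero_le r)).1 k + (lineColumn hij h2).1 k =
      (lineColumn hij h1).1 k + (lineColumn hij h1).1 k
    simp only [lineColumn_apply]
    grind
  · refine ⟨fun a ha => ?_, fun hsub => ?_⟩
    · obtain ⟨m, hm, hm2, rfl⟩ := hmem a ha
      exact hS m hm (by omega)
    · obtain ⟨m, hm, hm2, h⟩ := hmem _ (hsub (hS 3 hr le_rfl))
      exact lineColumn_ne hij hr hm (by omega) h

/-- No monomial of a circuit divides the monomial of multidegree `(2r - 3) e_i + 3 e_j` given by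
`r e_i` and `(r - 3) e_i + 3 e_j`. -/
lemma not_le_of_isCircuit {i j : Fin d} (hij : i ≠ j) (hr : 3 ≤ r)
    {u v : veroneseColumns d r →₀ ℕ} (h : IsCircuit K (veronese d r) u v) :
    ¬ u ≤ pairExp (lineColumn hij (Nat.zero_le r)) (lineColumn hij hr) := by
  intro hle
  obtain ⟨w, hw⟩ := exists_add_of_le hle
  have huv := binomial_mem_toricIdeal.1 h.1
  have hne : u ≠ v := by
    rintro rfl
    exact h.2.1.ne_zero (binomial_self u)
  have hmd : multidegree (veronese d r)
      (pairExp (lineColumn hij (Nat.zero_le r)) (lineColumn hij hr)) =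
      multidegree (veronese d r) (v + w) := by rw [hw, map_add, map_add, huv]
  rcases eq_pairExp_of_multidegree_eq hij hr hmd with h' | h'
  · rw [hw] at h'
    exact hne (add_right_cancel h').symm
  -- The factor `w` divides both `x_0 x_3` and `x_1 x_2`, which have no variable in common.
  · have hw0 : w = 0 := by
      ext a
      by_contra hne0
      have e1 := DFunLike.congr_fun hw a
      have e2 := DFunLike.congr_fun h' a
      have n01 := lineColumn_ne hij (Nat.zero_le r) (show 1 ≤ r by omega) (by omega)
      have n02 := lineColumn_ne hij (Nat.zero_le r) (show 2 ≤ r by omega) (by omega)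
      have n31 := lineColumn_ne hij hr (show 1 ≤ r by omega) (by omega)
      have n32 := lineColumn_ne hij hr (show 2 ≤ r by omega) (by omega)
      simp only [pairExp, Finsupp.add_apply, Finsupp.single_apply] at e1 e2
      simp only [Finsupp.coe_zero, Pi.zero_apply] at hne0
      grind
    rw [hw0, add_zero] at hw h'
    obtain ⟨u', v', hne', hmem', hss⟩ := exists_binomialSupport_ssubset (K := K) hij hr (u := u)
      (v := v) (by
        intro m hm hm3
        rw [← hw, h']
        simp only [binomialSupport, Set.mem_union, Set.mem_ofPred_eq]
        interval_cases m <;> simp [pairExp])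
    exact h.2.2 u' v' hne' hmem' hss

lemma IsCircuit.symm {ι : Type*} {A : Matrix (Fin d) ι ℤ} {u v : ι →₀ ℕ}
    (h : IsCircuit K A u v) : IsCircuit K A v u := by
  refine ⟨binomial_mem_symm h.1, ?_, fun u' v' hne hmem => ?_⟩
  · rw [binomial_swap]
    exact (Associated.refl _).neg_left.symm.irreducible h.2.1
  · have := h.2.2 u' v' hne hmem
    rwa [binomialSupport, binomialSupport, Set.union_comm {j | v j ≠ 0}]

theorem toricIdeal_veronese_ne (hd : 2 ≤ d) (hr : 3 ≤ r) :
    toricIdeal K (veronese d r) ≠ Ideal.span (circuitsSomeSquarefree K (veronese d r)) := by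
  intro heq
  have hij : (⟨0, by omega⟩ : Fin d) ≠ ⟨1, by omega⟩ := by simp
  have h1 : 1 ≤ r := by omega
  have h2 : 2 ≤ r := by omega
  set m := pairExp (lineColumn hij (Nat.zero_le r)) (lineColumn hij hr) with hm
  -- The multiplier `g` lets the statement pass through ideal multiplication. The squarefreeness of
  -- the generators plays no role.
  have hzero : ∀ f ∈ Ideal.span (circuitsSomeSquarefree K (veronese d r)),
      ∀ g, coeff m (g * f) = 0 := by
    intro f hf
    induction hf using Submodule.span_induction with
    | mem f hf =>
      obtain ⟨u, v, rfl, h, -⟩ := hf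
      intro g
      rw [binomial, mul_sub, coeff_sub, coeff_mul_monomial', coeff_mul_monomial',
        if_neg (not_le_of_isCircuit hij hr h), if_neg (not_le_of_isCircuit hij hr h.symm), sub_zero]
    | zero => simp
    | add f g _ _ hf hg => intro p; rw [mul_add, coeff_add, hf, hg, add_zero]
    | smul g f _ hf => intro p; rw [smul_eq_mul, ← mul_assoc]; exact hf _
  have hmem : binomial K m (pairExp (lineColumn hij h1) (lineColumn hij h2)) ∈
      toricIdeal K (veronese d r) := by
    rw [binomial_mem_toricIdeal]
    ext k
    rw [multidegree_pairExp, multidegree_pairExp]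
    change (lineColumn hij (Nat.zero_le r)).1 k + (lineColumn hij hr).1 k =
      (lineColumn hij h1).1 k + (lineColumn hij h2).1 k
    simp only [lineColumn_apply]
    grind
  rw [heq] at hmem
  have := hzero _ hmem 1
  rw [one_mul] at this
  have hne : pairExp (lineColumn hij h1) (lineColumn hij h2) ≠ m := by
    intro h
    have := DFunLike.congr_fun h (lineColumn hij h1)
    simp [hm, pairExp, Finsupp.single_apply, lineColumn_ne hij (Nat.zero_le r) h1 zero_ne_one,
      lineColumn_ne hij hr h1 (by omega)] at this
  simp [binomial, coeff_monomial, hne] at this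

end VeroneseHigher

end Toric

theorem theorem1p3 (K : Type*) [Field K] (d r : ℕ) (hd : 2 ≤ d) (hr : 2 ≤ r) :
    Toric.toricIdeal K (Toric.squarefreeVeronese d r) =
        Ideal.span (Toric.circuitsBothSquarefree K (Toric.squarefreeVeronese d r)) ∧
      (Toric.toricIdeal K (Toric.veronese d r) =
          Ideal.span (Toric.circuitsSomeSquarefree K (Toric.veronese d r)) ↔ r = 2) := by
  refine ⟨Toric.toricIdeal_squarefreeVeronese (by omega), fun h => ?_, ?_⟩
  · by_contra hne
    exact Toric.toricIdeal_veronese_ne hd (by omega) h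
  · rintro rfl
    exact Toric.toricIdeal_veronese_two
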